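/- Let $G$ be a compact Lie group with an $\mathrm{Ad}$-invariant inner product on its Lie algebra $\mathfrak g$, and let $\Delta=\sum_k X_kX^k$ be the corresponding Laplacian (quadratic Casimir operator) on $C^\infty(G)$, where $(X_k)$ is a basis of $\mathfrak g$, $(X^k)$ is the dual basis with respect to the inner product, and elements of $\mathfrak g$ act as left-invariant vector fields. An oriented graph $\Lambda$ has a set of vertices $\Lambda^0$ and a finite set of edges $\Lambda^1$ with source and target maps $s,t:\Lambda^1\to\Lambda^0$. Put $\mathcal H_\Lambda=L^2(G^{\Lambda^1})$ with respect to normalized Haar measure. The gauge group $\mathcal G_\Lambda=G^{\Lambda^0}$ acts on $G^{\Lambda^1}$ by $(g\cdot a)_e=g_{s(e)}a_eg_{t(e)}^{-1}$; let $\mathcal H_\Lambda^{\mathcal G_\Lambda}$ be the closed subspace of all $\psi\in\mathcal H_\Lambda$ with $\psi(g\,\cdot)=\psi$ for every $g\in\mathcal G_\Lambda$. For real constants $(I_e)_{e\in\Lambda^1}$ the operator $\sum_{e\in\Lambda^1}-\tfrac12 I_e\Delta_e$ with domain $C^\infty(G^{\Lambda^1})$, where $\Delta_e$ is $\Delta$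 acting in the variable $a_e$, is closable in $\mathcal H_\Lambda$; its closure $H_0$, with domain $\mathrm{Dom}(H_0)$, is the free electric Hamiltonian. Let $\iota$ be a refinement of $\Lambda_i$ by $\Lambda_j$: a functor from the free (path) category generated by $\Lambda_i$ to that generated by $\Lambda_j$ which is injective on vertices and maps each edge $e\in\Lambda_i^1$ to a nontrivial oriented path $\iota(e)=(e_1,\dots,e_n)$ in $\Lambda_j$ with pairwise distinct edges, such that $\iota(e)$ and $\iota(e')$ have no common edge when $e\ne e'$. Let $R:G^{\Lambda_j^1}\to G^{\Lambda_i^1}$, $R(a)_e=a_{e_1}\cdots a_{e_n}$, and let $u:\mathcal H_i\to\mathcal H_j$, $u\psi=\psi\circ R$, which is an isometry that maps $\mathcal H_i^{\mathcal G_i}$ into $\mathcal H_j^{\mathcal G_j}$; let $u_{\mathrm{red}}:\mathcal H_i^{\mathcal G_i}\to\mathcal H_j^{\mathcal G_j}$ be its restriction. Let $H_{0,i}$ and $H_{0,j}$ be the free electric Hamiltonians for constants $(I_{i,e})_{e\in\Lambda_i^1}$ and $(I_{j,e})_{e\in\Lambda_j^1}$, and suppose that for each $e\in\Lambda_i^1$,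 with $\iota(e)=(e_1,\dots,e_n)$, $$I_{i,e}=\sum_{k=1}^n I_{j,e_k}.$$ Then: 1. $u(\mathrm{Dom}(H_{0,i}))\subseteq\mathrm{Dom}(H_{0,j})$, and $H_{0,j}u\psi=uH_{0,i}\psi$ for all $\psi\in\mathrm{Dom}(H_{0,i})$. 2. The restrictions $H_{0,i}^{\mathrm{red}}$ and $H_{0,j}^{\mathrm{red}}$ of $H_{0,i}$ and $H_{0,j}$ to $\mathrm{Dom}(H_{0,i})\cap\mathcal H_i^{\mathcal G_i}$ and $\mathrm{Dom}(H_{0,j})\cap\mathcal H_j^{\mathcal G_j}$ take values in $\mathcal H_i^{\mathcal G_i}$ and $\mathcal H_j^{\mathcal G_j}$, respectively; $u(\mathrm{Dom}(H_{0,i})\cap\mathcal H_i^{\mathcal G_i})\subseteq\mathrm{Dom}(H_{0,j})\cap\mathcal H_j^{\mathcal G_j}$; and $H_{0,j}^{\mathrm{red}}u_{\mathrm{red}}\psi=u_{\mathrm{red}}H_{0,i}^{\mathrm{red}}\psi$ for all $\psi\in\mathrm{Dom}(H_{0,i})\cap\mathcal H_i^{\mathcal G_i}$. -/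

import Mathlib

open MeasureTheory CategoryTheory
open scoped Manifold ContDiff ENNReal

noncomputable section

namespace LatticeGauge

/-! ### Oriented graphs and refinements

An oriented graph is a quiver `V`: the vertices are the points of `V`, the edges are the elements
of `Quiver.Total V`, and the source and target of an edge `e` are `e.left` and `e.right`.
The free category generated by the graph is `CategoryTheory.Paths V`. -/

section Graph

/-- The list `(e₁, …, eₙ)` of the edges of a path, in the order in which they are traversed. -/
def pathEdges {V : Type*} [Quiver V] : {x y : V} → Quiver.Path x y → List (Quiver.Total V)
  | _, _, .nil => []
  | _, _, .cons p e => pathEdges p ++ [⟨_, _, e⟩]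

/-- The edges of the path to which a functor between free categories sends the edge `e`. -/
def imageEdges {V W : Type*} [Quiver V] [Quiver W] (F : Paths V ⥤ Paths W) (e : Quiver.Total V) :
    List (Quiver.Total W) :=
  pathEdges (V := W) (F.map ((Paths.of V).map e.hom))

/-- A refinement of the graph `V` by the graph `W`: a functor between the free categories that is
injective on vertices, sends each edge to a nontrivial path that runs through no edge twice, and
sends distinct edges to paths without common edges. -/
structure Refinement (V W : Type*) [Quiver V] [Quiver W] where
  functor : Paths V ⥤ Paths W
  obj_injective : Function.Injective functor.obj
  edges_ne_nil : ∀ e, imageEdges functor e ≠ []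
  edges_nodup : ∀ e, (imageEdges functor e).Nodup
  edges_disjoint : ∀ e e', e ≠ e' → (imageEdges functor e).Disjoint (imageEdges functor e')

/-- The path `(e₁, …, eₙ)` into which the edge `e` is refined. -/
def Refinement.path {V W : Type*} [Quiver V] [Quiver W] (r : Refinement V W) (e : Quiver.Total V) :
    List (Quiver.Total W) :=
  imageEdges r.functor e

/-- The action of the gauge group `G ^ vertices` on the configuration space `G ^ edges`. -/
def gaugeAct {V : Type*} [Quiver V] {G : Type*} [Group G] (g : V → G) (a : Quiver.Total V → G) :
    Quiver.Total V → G :=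
  fun e => g e.left * a e * (g e.right)⁻¹

/-- The map of configuration spaces `R(a)_e = a_{e₁} ⋯ a_{eₙ}` induced by a refinement. -/
def Refinement.config {V W : Type*} [Quiver V] [Quiver W] (r : Refinement V W)
    {G : Type*} [Group G] (a : Quiver.Total W → G) : Quiver.Total V → G :=
  fun e => ((r.path e).map a).prod

/-- The homomorphism of gauge groups induced by a refinement. -/
def Refinement.gauge {V W : Type*} [Quiver V] [Quiver W] (r : Refinement V W)
    {G : Type*} (g : W → G) : V → G :=
  fun x => g (r.functor.obj x)

lemma prod_pathEdges_gaugeAct {V : Type*} [Quiver V] {G : Type*} [Group G] (g : V → G)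
    (a : Quiver.Total V → G) {x y : V} (p : Quiver.Path x y) :
    ((pathEdges p).map (gaugeAct g a)).prod = g x * ((pathEdges p).map a).prod * (g y)⁻¹ := by
  induction p with
  | nil => simp [pathEdges]
  | cons p e ih => simp [pathEdges, ih, gaugeAct, mul_assoc]

lemma Refinement.config_gaugeAct {V W : Type*} [Quiver V] [Quiver W] (r : Refinement V W)
    {G : Type*} [Group G] (g : W → G) (a : Quiver.Total W → G) :
    r.config (gaugeAct g a) = gaugeAct (r.gauge g) (r.config a) := by
  funext e
  exact prod_pathEdges_gaugeAct g a _

end Graph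

/-! ### The product manifold `G ^ ι` -/

section Smooth

variable {ι : Type*} [Fintype ι]
  {E : Type*} [NormedAddCommGroup E] [NormedSpace ℝ E]
  {G : Type*} [TopologicalSpace G] [ChartedSpace E G]

/-- The model of the product manifold `ι → G`, for `G` modelled on `E`. -/
abbrev configModel (ι : Type*) [Fintype ι] (E : Type*) [NormedAddCommGroup E] [NormedSpace ℝ E] :
    ModelWithCorners ℝ (ι → E) (ModelPi fun _ : ι => E) :=
  ModelWithCorners.pi fun _ : ι => 𝓘(ℝ, E)

lemma contMDiff_eval (n : WithTop ℕ∞) (e : ι) :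
    ContMDiff (configModel ι E) 𝓘(ℝ, E) n (fun a : ι → G => a e) := by
  intro a
  rw [contMDiffAt_iff]
  refine ⟨(continuous_apply e).continuousAt, ?_⟩
  have h : ContDiffAt ℝ n (fun v : ι → E => v e) (extChartAt (configModel ι E) a a) :=
    (contDiff_apply ℝ E e).contDiffAt
  refine h.contDiffWithinAt.congr_of_eventuallyEq ?_ ?_
  · have ho := extChartAt_target_mem_nhdsWithin (I := configModel ι E) a
    filter_upwards [ho] with v hv
    have := (extChartAt (configModel ι E) a).right_inv hv
    exact congrFun this e
  · have := (extChartAt (configModel ι E) a).left_inv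
      (mem_extChartAt_source (I := configModel ι E) a)
    simp only [Function.comp_apply, this]
    rfl

lemma contMDiff_into_config {F H M : Type*} [NormedAddCommGroup F] [NormedSpace ℝ F]
    [TopologicalSpace H] {I : ModelWithCorners ℝ F H} [TopologicalSpace M] [ChartedSpace H M]
    {n : WithTop ℕ∞} {f : M → ι → G} (hf : ∀ e, ContMDiff I 𝓘(ℝ, E) n fun x => f x e) :
    ContMDiff I (configModel ι E) n f := by
  intro x
  rw [contMDiffAt_iff]
  refine ⟨continuousAt_pi.2 fun e => (hf e x).continuousAt, ?_⟩
  exact contDiffWithinAt_pi.2 fun e => (contMDiffAt_iff.1 (hf e x)).2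

instance isManifold_config (n : WithTop ℕ∞) [IsManifold 𝓘(ℝ, E) n G] :
    IsManifold (configModel ι E) n (ι → G) := by
  apply isManifold_of_contDiffOn
  rintro _ _ ⟨c, hc, rfl⟩ ⟨c', hc', rfl⟩
  refine contDiffOn_pi.2 fun e => ?_
  have h := (contDiffGroupoid n 𝓘(ℝ, E)).compatible (hc e trivial) (hc' e trivial)
  rw [contDiffGroupoid, mem_groupoid_of_pregroupoid] at h
  refine ContDiffOn.comp (t := _) (g := _) (f := fun v : ι → E => v e) h.1
    (contDiff_apply ℝ E e).contDiffOn ?_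
  rintro v ⟨hv, -⟩
  exact ⟨⟨hv.1 e trivial, hv.2 e trivial⟩, Set.mem_range_self _⟩

open Classical in
lemma smooth_slice (e : ι) {f : (ι → G) → ℂ}
    (hf : ContMDiff (configModel ι E) 𝓘(ℝ, ℂ) ∞ f) (a : ι → G) :
    ContMDiff 𝓘(ℝ, E) 𝓘(ℝ, ℂ) ∞ (fun g => f (Function.update a e g)) := by
  refine hf.comp (contMDiff_into_config fun e' => ?_)
  by_cases h : e' = e
  · subst h; simp only [Function.update_self]; exact contMDiff_id
  · simpa [h] using contMDiff_const

variable (ι E G) in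
/-- The space `C^∞(G ^ ι)` of smooth complex functions on the configuration space. -/
def smoothFunctions : Submodule ℂ ((ι → G) → ℂ) where
  carrier := {f | ContMDiff (configModel ι E) 𝓘(ℝ, ℂ) ∞ f}
  add_mem' := fun hf hg => hf.add hg
  zero_mem' := contMDiff_const
  smul_mem' := fun c _ hf => (contDiff_const_smul c (n := ∞) (𝕜 := ℝ) (F := ℂ)).contMDiff.comp hf

end Smooth

/-! ### The Laplacian of a Lie group with an invariant metric -/

section Laplacian

variable {E : Type*} [NormedAddCommGroup E] [NormedSpace ℝ E]
  {G : Type*} [TopologicalSpace G] [ChartedSpace E G] [Group G]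

variable (E) in
/-- The adjoint representation: `Ad g` is the derivative at `1` of `h ↦ g h g⁻¹`. (This derivative
takes values in the tangent space at `g 1 g⁻¹`, which is the point `1`.) -/
def Ad (g : G) : GroupLieAlgebra 𝓘(ℝ, E) G →L[ℝ] GroupLieAlgebra 𝓘(ℝ, E) G :=
  mfderiv 𝓘(ℝ, E) 𝓘(ℝ, E) (fun h : G => g * h * g⁻¹) 1

variable (E G) in
/-- An `Ad`-invariant inner product on the Lie algebra of `G`; this is the same as a bi-invariant
Riemannian metric on `G`. -/
structure InvariantInner where
  form : LinearMap.BilinForm ℝ (GroupLieAlgebra 𝓘(ℝ, E) G)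
  symm : ∀ X Y, form X Y = form Y X
  pos : ∀ X, X ≠ 0 → 0 < form X X
  ad_invariant : ∀ (g : G) (X Y), form (Ad E g X) (Ad E g Y) = form X Y

lemma InvariantInner.nondegenerate (B : InvariantInner E G) : B.form.Nondegenerate := by
  constructor
  · intro X h
    by_contra hX
    exact (B.pos X hX).ne' (h X)
  · intro X h
    by_contra hX
    exact (B.pos X hX).ne' (h X)

/-- The derivative of `φ : G → ℂ` along the left invariant vector field of `X`. -/
def lieDeriv (X : GroupLieAlgebra 𝓘(ℝ, E) G) (φ : G → ℂ) (g : G) : ℂ :=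
  mfderiv 𝓘(ℝ, E) 𝓘(ℝ, ℂ) φ g (mulInvariantVectorField X g)

open Classical in
/-- The derivative of `f : G ^ ι → ℂ` along the left invariant vector field of `X` in the
variable `e`. -/
def edgeDeriv {ι : Type*} (e : ι) (X : GroupLieAlgebra 𝓘(ℝ, E) G) (f : (ι → G) → ℂ)
    (a : ι → G) : ℂ :=
  lieDeriv X (fun g => f (Function.update a e g)) (a e)

instance finiteDimensional_lieAlgebra [FiniteDimensional ℝ E] :
    FiniteDimensional ℝ (GroupLieAlgebra 𝓘(ℝ, E) G) :=
  inferInstanceAs (FiniteDimensional ℝ E)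

/-- The Laplacian of `G`, i.e. the differential operator `∑ₖ Xₖ X^k` of the quadratic Casimir
element, where `(X_k)` is a basis of the Lie algebra and `(X^k)` is the dual basis with respect to
the invariant inner product (the operator does not depend on the basis). -/
def laplacian [FiniteDimensional ℝ E] (B : InvariantInner E G) (φ : G → ℂ) (g : G) : ℂ :=
  let b := Module.finBasis ℝ (GroupLieAlgebra 𝓘(ℝ, E) G)
  let b' := B.form.dualBasis B.nondegenerate b
  ∑ k, lieDeriv (b k) (lieDeriv (b' k) φ) g

open Classical in
/-- The Laplacian `Δ_e`, acting in the variable `e`. -/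
def edgeLaplacian [FiniteDimensional ℝ E] {ι : Type*} (B : InvariantInner E G) (e : ι)
    (f : (ι → G) → ℂ) (a : ι → G) : ℂ :=
  laplacian B (fun g => f (Function.update a e g)) (a e)

/-- The differential operator `∑_e -(1/2) I_e Δ_e`. -/
def electricOp [FiniteDimensional ℝ E] {ι : Type*} [Fintype ι] (B : InvariantInner E G)
    (c : ι → ℝ) (f : (ι → G) → ℂ) (a : ι → G) : ℂ :=
  ∑ e, -(1 / 2 : ℂ) * (c e : ℂ) * edgeLaplacian B e f a

open Classical in
lemma edgeDeriv_update {ι : Type*} (e : ι) (X : GroupLieAlgebra 𝓘(ℝ, E) G) (f : (ι → G) → ℂ)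
    (a : ι → G) (g : G) :
    edgeDeriv e X f (Function.update a e g) =
      lieDeriv X (fun g => f (Function.update a e g)) g := by
  simp [edgeDeriv]

lemma edgeLaplacian_eq [FiniteDimensional ℝ E] {ι : Type*} (B : InvariantInner E G) (e : ι)
    (f : (ι → G) → ℂ) :
    edgeLaplacian B e f = fun a =>
      let b := Module.finBasis ℝ (GroupLieAlgebra 𝓘(ℝ, E) G)
      let b' := B.form.dualBasis B.nondegenerate b
      ∑ k, edgeDeriv e (b k) (edgeDeriv e (b' k) f) a := by
  funext a
  simp only [edgeLaplacian, laplacian]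
  refine Finset.sum_congr rfl fun k _ => ?_
  conv_rhs => rw [edgeDeriv]
  simp only [edgeDeriv_update]

lemma lieDeriv_add (X : GroupLieAlgebra 𝓘(ℝ, E) G) {φ ψ : G → ℂ} {g : G}
    (hφ : MDifferentiableAt 𝓘(ℝ, E) 𝓘(ℝ, ℂ) φ g) (hψ : MDifferentiableAt 𝓘(ℝ, E) 𝓘(ℝ, ℂ) ψ g) :
    lieDeriv X (φ + ψ) g = lieDeriv X φ g + lieDeriv X ψ g := by
  have := (hφ.hasMFDerivAt.add hψ.hasMFDerivAt).mfderiv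
  simp only [lieDeriv]
  rw [this]
  rfl

lemma lieDeriv_smul (X : GroupLieAlgebra 𝓘(ℝ, E) G) (c : ℂ) {φ : G → ℂ} {g : G}
    (hφ : MDifferentiableAt 𝓘(ℝ, E) 𝓘(ℝ, ℂ) φ g) :
    lieDeriv X (c • φ) g = c • lieDeriv X φ g := by
  have := (((ContinuousLinearMap.mul ℝ ℂ c).hasMFDerivAt (x := φ g)).comp g
    hφ.hasMFDerivAt).mfderiv
  simp only [lieDeriv]
  change mfderiv 𝓘(ℝ, E) 𝓘(ℝ, ℂ) (c • φ) g = _ at this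
  rw [this]
  rfl

lemma edgeDeriv_add {ι : Type*} [Fintype ι] (e : ι) (X : GroupLieAlgebra 𝓘(ℝ, E) G)
    {f h : (ι → G) → ℂ} (hf : f ∈ smoothFunctions ι E G) (hh : h ∈ smoothFunctions ι E G) :
    edgeDeriv e X (f + h) = edgeDeriv e X f + edgeDeriv e X h := by
  funext a
  exact lieDeriv_add X ((smooth_slice e hf a).mdifferentiable (by simp) _)
    ((smooth_slice e hh a).mdifferentiable (by simp) _)

lemma edgeDeriv_smul {ι : Type*} [Fintype ι] (e : ι) (X : GroupLieAlgebra 𝓘(ℝ, E) G) (c : ℂ)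
    {f : (ι → G) → ℂ} (hf : f ∈ smoothFunctions ι E G) :
    edgeDeriv e X (c • f) = c • edgeDeriv e X f := by
  funext a
  exact lieDeriv_smul X c ((smooth_slice e hf a).mdifferentiable (by simp) _)

variable {ι : Type*} [Fintype ι] [LieGroup 𝓘(ℝ, E) ∞ G]

open Classical in
lemma edgeDeriv_eq (e : ι) (X : GroupLieAlgebra 𝓘(ℝ, E) G) {f : (ι → G) → ℂ}
    (hf : f ∈ smoothFunctions ι E G) (a : ι → G) :
    edgeDeriv e X f a =
      mfderiv 𝓘(ℝ, E) 𝓘(ℝ, ℂ) (fun g => f (Function.update a e (a e * g))) 1 X := by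
  have h1 : MDifferentiableAt 𝓘(ℝ, E) 𝓘(ℝ, ℂ) (fun g => f (Function.update a e g)) (a e * 1) :=
    (smooth_slice e hf a).mdifferentiable (by simp) _
  have h2 : MDifferentiableAt 𝓘(ℝ, E) 𝓘(ℝ, E) (fun g : G => a e * g) 1 :=
    (contMDiff_mul_left (I := 𝓘(ℝ, E)) (n := ∞)).mdifferentiable (by simp) _
  have := mfderiv_comp (1 : G) h1 h2
  change mfderiv 𝓘(ℝ, E) 𝓘(ℝ, ℂ) (fun g => f (Function.update a e (a e * g))) 1 = _ at this
  rw [this]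
  change mfderiv 𝓘(ℝ, E) 𝓘(ℝ, ℂ) (fun g => f (Function.update a e g)) (a e) _ =
    mfderiv 𝓘(ℝ, E) 𝓘(ℝ, ℂ) (fun g => f (Function.update a e g)) (a e * 1) _
  rw [mul_one]
  rfl

open Classical in
lemma smooth_edgeDeriv (e : ι) (X : GroupLieAlgebra 𝓘(ℝ, E) G) {f : (ι → G) → ℂ}
    (hf : f ∈ smoothFunctions ι E G) : edgeDeriv e X f ∈ smoothFunctions ι E G := by
  intro a
  have hM : IsManifold 𝓘(ℝ, E) 1 G := IsManifold.of_le (n := ∞) (m := 1) (by simp)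
  have hF : ContMDiff ((configModel ι E).prod 𝓘(ℝ, E)) 𝓘(ℝ, ℂ) ∞
      (Function.uncurry fun (a : ι → G) (g : G) => f (Function.update a e (a e * g))) := by
    refine ContMDiff.comp (I' := configModel ι E) hf (contMDiff_into_config fun e' => ?_)
    by_cases h : e' = e
    · subst h
      have h0 : ContMDiff ((configModel ι E).prod 𝓘(ℝ, E)) 𝓘(ℝ, E) ∞
          (fun p : (ι → G) × G => p.1 e' * p.2) :=
        ((contMDiff_eval ∞ e').comp contMDiff_fst).mul contMDiff_snd
      simpa using h0
    · have h0 : ContMDiff ((configModel ι E).prod 𝓘(ℝ, E)) 𝓘(ℝ, E) ∞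
          (fun p : (ι → G) × G => p.1 e') := (contMDiff_eval ∞ e').comp contMDiff_fst
      simpa [h] using h0
  have h := ContMDiffAt.mfderiv (x₀ := a) (m := ∞) (n := ∞)
    (fun (a : ι → G) (g : G) => f (Function.update a e (a e * g))) (fun _ => 1)
    (hF _) contMDiffAt_const (by simp)
  let D : (ι → G) → E →L[ℝ] ℂ := fun b =>
    mfderiv 𝓘(ℝ, E) 𝓘(ℝ, ℂ) (fun g => f (Function.update b e (b e * g))) 1
  have hD : ContMDiffAt (configModel ι E) 𝓘(ℝ, E →L[ℝ] ℂ) ∞ D a := by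
    refine h.congr_of_eventuallyEq (Filter.Eventually.of_forall fun b => ?_)
    rw [inTangentCoordinates_eq (I := 𝓘(ℝ, E)) (I' := 𝓘(ℝ, ℂ)) (M := G) (M' := ℂ)
      (fun _ => 1) _ D (mem_chart_source E (1 : G)) (Set.mem_univ _)]
    ext v
    have h1 : (tangentBundleCore 𝓘(ℝ, E) G).coordChange (achart E (1 : G)) (achart E (1 : G)) 1 v
        = v := (tangentBundleCore 𝓘(ℝ, E) G).coordChange_self _ _ (mem_chart_source E (1 : G)) _
    simp only [ContinuousLinearMap.comp_apply, h1, tangentBundleCore_coordChange_model_space]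
    rfl
  have hX : ContMDiffAt (configModel ι E) 𝓘(ℝ, ℂ) ∞ (fun b => D b (show E from X)) a :=
    hD.clm_apply contMDiffAt_const
  exact hX.congr_of_eventuallyEq (Filter.Eventually.of_forall fun b => edgeDeriv_eq e X hf b)

lemma smooth_electricOp [FiniteDimensional ℝ E] (B : InvariantInner E G) (c : ι → ℝ)
    {f : (ι → G) → ℂ} (hf : f ∈ smoothFunctions ι E G) :
    electricOp B c f ∈ smoothFunctions ι E G := by
  have : electricOp B c f = ∑ e, (-(1 / 2 : ℂ) * (c e : ℂ)) • edgeLaplacian B e f := by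
    funext a
    simp [electricOp]
  rw [this]
  refine Submodule.sum_mem _ fun e _ => Submodule.smul_mem _ _ ?_
  rw [edgeLaplacian_eq]
  have h2 : ∀ k, edgeDeriv e (Module.finBasis ℝ (GroupLieAlgebra 𝓘(ℝ, E) G) k) (edgeDeriv e
      (B.form.dualBasis B.nondegenerate (Module.finBasis ℝ (GroupLieAlgebra 𝓘(ℝ, E) G)) k) f) ∈
      smoothFunctions ι E G := fun k => smooth_edgeDeriv e _ (smooth_edgeDeriv e _ hf)
  convert Submodule.sum_mem _ (fun k (_ : k ∈ Finset.univ) => h2 k) using 1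
  funext a
  simp

/-- The operator `∑_e -(1/2) I_e Δ_e` on the space of smooth functions. -/
def electricMap [FiniteDimensional ℝ E] (B : InvariantInner E G) (c : ι → ℝ) :
    smoothFunctions ι E G →ₗ[ℂ] smoothFunctions ι E G where
  toFun f := ⟨electricOp B c f, smooth_electricOp B c f.2⟩
  map_add' f h := by
    ext a
    simp only [electricOp, edgeLaplacian_eq, Submodule.coe_add, Pi.add_apply]
    rw [← Finset.sum_add_distrib]
    refine Finset.sum_congr rfl fun e _ => ?_
    rw [← mul_add, ← Finset.sum_add_distrib]
    refine congrArg _ (Finset.sum_congr rfl fun k _ => ?_)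
    rw [edgeDeriv_add e _ f.2 h.2,
      edgeDeriv_add e _ (smooth_edgeDeriv e _ f.2) (smooth_edgeDeriv e _ h.2)]
    rfl
  map_smul' z f := by
    ext a
    simp only [electricOp, edgeLaplacian_eq, Submodule.coe_smul, Pi.smul_apply, smul_eq_mul,
      RingHom.id_apply]
    rw [Finset.mul_sum]
    refine Finset.sum_congr rfl fun e _ => ?_
    conv_rhs => rw [mul_left_comm, Finset.mul_sum]
    refine congrArg _ (Finset.sum_congr rfl fun k _ => ?_)
    rw [edgeDeriv_smul e _ z f.2, edgeDeriv_smul e _ z (smooth_edgeDeriv e _ f.2)]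
    rfl

end Laplacian

/-! ### The Hilbert spaces -/

section HilbertSpace

section Measure

variable (G : Type*) [Group G] [TopologicalSpace G] [IsTopologicalGroup G]
  [CompactSpace G] [MeasurableSpace G] [BorelSpace G]

/-- The normalized Haar measure of the compact group `G`. -/
def haarProb : Measure G := Measure.haarMeasure ⊤

instance haarProb_isHaarMeasure : (haarProb G).IsHaarMeasure :=
  inferInstanceAs (Measure.haarMeasure ⊤).IsHaarMeasure

instance haarProb_isProbabilityMeasure : IsProbabilityMeasure (haarProb G) :=
  ⟨by simpa [haarProb] using
    Measure.haarMeasure_self (K₀ := (⊤ : TopologicalSpace.PositiveCompacts G))⟩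

instance haarProb_isMulRightInvariant : (haarProb G).IsMulRightInvariant where
  map_mul_right_eq_self g := by
    have : IsProbabilityMeasure ((haarProb G).map (· * g)) :=
      Measure.isProbabilityMeasure_map (measurable_mul_const g).aemeasurable
    have : ((haarProb G).map (· * g)).IsHaarMeasure :=
      Measure.isHaarMeasure_of_isCompact_nonempty_interior _ Set.univ isCompact_univ
        (by simp) (by simp) (by simp)
    exact Measure.isHaarMeasure_eq_of_isProbabilityMeasure _ _

/-- The normalized Haar measure of the configuration space `G ^ ι`: the product measure. -/
def configMeasure (ι : Type*) [Fintype ι] : Measure (ι → G) := Measure.pi fun _ => haarProb G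

instance configMeasure_isProbabilityMeasure (ι : Type*) [Fintype ι] :
    IsProbabilityMeasure (configMeasure G ι) :=
  inferInstanceAs (IsProbabilityMeasure (Measure.pi fun _ : ι => haarProb G))

instance configMeasure_isHaarMeasure [SecondCountableTopology G] (ι : Type*) [Fintype ι] :
    (configMeasure G ι).IsHaarMeasure :=
  inferInstanceAs (Measure.pi fun _ : ι => haarProb G).IsHaarMeasure

/-- The Hilbert space `L²(G ^ ι)`. -/
abbrev L2 (ι : Type*) [Fintype ι] : Type _ := Lp ℂ 2 (configMeasure G ι)

end Measure

variable {V W : Type*} [Quiver V] [Quiver W]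
  [Fintype (Quiver.Total V)] [Fintype (Quiver.Total W)]
  {G : Type*} [Group G] [TopologicalSpace G] [IsTopologicalGroup G]
  [CompactSpace G] [MeasurableSpace G] [BorelSpace G] [SecondCountableTopology G]

lemma measurePreserving_gaugeAct (g : V → G) :
    MeasurePreserving (gaugeAct g) (configMeasure G (Quiver.Total V))
      (configMeasure G (Quiver.Total V)) :=
  measurePreserving_pi (fun _ : Quiver.Total V => haarProb G) (fun _ => haarProb G)
    (f := fun e x => g e.left * x * (g e.right)⁻¹) fun e =>
    (measurePreserving_mul_right (haarProb G) (g e.right)⁻¹).comp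
      (measurePreserving_mul_left (haarProb G) (g e.left))

/-- The unitary operator `U(g) ψ = ψ ∘ (g · )` of a gauge transformation. -/
def gaugeOp (g : V → G) : L2 G (Quiver.Total V) →ₗᵢ[ℂ] L2 G (Quiver.Total V) :=
  Lp.compMeasurePreservingₗᵢ ℂ (gaugeAct g) (measurePreserving_gaugeAct g)

variable (V G) in
/-- The subspace of gauge invariant vectors. -/
def gaugeInvariant : Submodule ℂ (L2 G (Quiver.Total V)) :=
  ⨅ g : V → G, LinearMap.eqLocus (gaugeOp g).toLinearMap LinearMap.id

lemma mem_gaugeInvariant {ψ : L2 G (Quiver.Total V)} :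
    ψ ∈ gaugeInvariant V G ↔ ∀ g : V → G, gaugeOp g ψ = ψ := by
  simp [gaugeInvariant, Submodule.mem_iInf, LinearMap.mem_eqLocus]

lemma Refinement.measurePreserving_config (r : Refinement V W) :
    MeasurePreserving (r.config (G := G)) (configMeasure G (Quiver.Total W))
      (configMeasure G (Quiver.Total V)) := by
  classical
  have hc : Continuous (r.config (G := G)) :=
    continuous_pi fun e => continuous_list_prod _ fun x _ => continuous_apply x
  refine ⟨hc.measurable, ?_⟩
  have hinv : ((configMeasure G (Quiver.Total W)).map (r.config (G := G))).IsMulLeftInvariant := by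
    refine ⟨fun h => ?_⟩
    let k : Quiver.Total W → G := fun x =>
      if hx : ∃ e, (r.path e).head? = some x then h hx.choose else 1
    have hk : ∀ a, r.config (k * a) = h * r.config a := by
      intro a
      funext e
      obtain ⟨x, l, hl⟩ := List.exists_cons_of_ne_nil (r.edges_ne_nil e)
      have hl' : r.path e = x :: l := hl
      have hmem : ∀ e' y, (r.path e').head? = some y → y ∈ r.path e → e' = e := by
        intro e' y h1 h2
        by_contra hne
        exact r.edges_disjoint e' e hne (List.mem_of_head? h1) h2
      have h1 : k x = h e := by
        have hx : ∃ e, (r.path e).head? = some x := ⟨e, by simp [hl']⟩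
        have := hmem _ x hx.choose_spec (by simp [hl'])
        simp only [k, dif_pos hx, this]
      have h2 : ∀ y ∈ l, k y = 1 := by
        intro y hy
        refine dif_neg ?_
        rintro ⟨e', he'⟩
        obtain rfl := hmem e' y he' (by simp [hl', hy])
        have hxy : x = y := by simpa [hl'] using he'
        have hnd : (r.path e').Nodup := r.edges_nodup e'
        rw [hl', List.nodup_cons] at hnd
        exact hnd.1 (hxy ▸ hy)
      have h3 : l.map (k * a) = l.map a :=
        List.map_congr_left fun y hy => by simp [h2 y hy]
      simp [Refinement.config, hl', h1, h3, mul_assoc]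
    rw [Measure.map_map (measurable_const_mul h) hc.measurable]
    have : (fun x => h * x) ∘ r.config (G := G) = r.config (G := G) ∘ fun a => k * a := by
      funext a
      exact (hk a).symm
    rw [this, ← Measure.map_map hc.measurable (measurable_const_mul k), map_mul_left_eq_self]
  have hp : IsProbabilityMeasure ((configMeasure G (Quiver.Total W)).map (r.config (G := G))) :=
    Measure.isProbabilityMeasure_map hc.measurable.aemeasurable
  have hH : ((configMeasure G (Quiver.Total W)).map (r.config (G := G))).IsHaarMeasure :=
    Measure.isHaarMeasure_of_isCompact_nonempty_interior _ Set.univ isCompact_univ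
      (by simp) (by simp) (by simp)
  exact Measure.isHaarMeasure_eq_of_isProbabilityMeasure _ _

/-- The isometry `u ψ = ψ ∘ R` induced by a refinement. -/
def Refinement.u (r : Refinement V W) (G : Type*) [Group G] [TopologicalSpace G]
    [IsTopologicalGroup G] [CompactSpace G] [MeasurableSpace G] [BorelSpace G]
    [SecondCountableTopology G] : L2 G (Quiver.Total V) →ₗᵢ[ℂ] L2 G (Quiver.Total W) :=
  Lp.compMeasurePreservingₗᵢ ℂ r.config r.measurePreserving_config

lemma Refinement.u_mem_gaugeInvariant (r : Refinement V W) {ψ : L2 G (Quiver.Total V)}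
    (hψ : ψ ∈ gaugeInvariant V G) : r.u G ψ ∈ gaugeInvariant W G := by
  rw [mem_gaugeInvariant] at hψ ⊢
  intro g
  refine Eq.trans ?_ (congrArg (r.u G) (hψ (r.gauge g)))
  apply Lp.ext
  have hR := r.measurePreserving_config (G := G)
  have h1 : gaugeOp g (r.u G ψ) =ᵐ[configMeasure G (Quiver.Total W)] r.u G ψ ∘ gaugeAct g :=
    Lp.coeFn_compMeasurePreserving _ (measurePreserving_gaugeAct g)
  have h2 : r.u G ψ ∘ gaugeAct g =ᵐ[configMeasure G (Quiver.Total W)]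
      (ψ ∘ r.config) ∘ gaugeAct g :=
    (measurePreserving_gaugeAct g).quasiMeasurePreserving.ae_eq_comp
      (Lp.coeFn_compMeasurePreserving _ hR)
  have h3 : r.u G (gaugeOp (r.gauge g) ψ) =ᵐ[configMeasure G (Quiver.Total W)]
      gaugeOp (r.gauge g) ψ ∘ r.config := Lp.coeFn_compMeasurePreserving _ hR
  have h4 : gaugeOp (r.gauge g) ψ ∘ r.config =ᵐ[configMeasure G (Quiver.Total W)]
      (ψ ∘ gaugeAct (r.gauge g)) ∘ r.config :=
    hR.quasiMeasurePreserving.ae_eq_comp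
      (Lp.coeFn_compMeasurePreserving _ (measurePreserving_gaugeAct (r.gauge g)))
  refine (h1.trans h2).trans (Filter.EventuallyEq.trans ?_ (h3.trans h4).symm)
  refine Filter.Eventually.of_forall fun a => ?_
  simp [r.config_gaugeAct]

/-- The restriction of the isometry `u` to the gauge invariant subspaces. -/
def Refinement.uRed (r : Refinement V W) (G : Type*) [Group G] [TopologicalSpace G]
    [IsTopologicalGroup G] [CompactSpace G] [MeasurableSpace G] [BorelSpace G]
    [SecondCountableTopology G] : gaugeInvariant V G →ₗᵢ[ℂ] gaugeInvariant W G where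
  toLinearMap := (r.u G).toLinearMap.restrict fun _ hψ => r.u_mem_gaugeInvariant hψ
  norm_map' ψ := (r.u G).norm_map ψ

end HilbertSpace

/-! ### The free electric Hamiltonian -/

section Hamiltonian

variable {ι : Type*} [Fintype ι]
  {E : Type*} [NormedAddCommGroup E] [NormedSpace ℝ E]
  {G : Type*} [TopologicalSpace G] [ChartedSpace E G] [Group G] [IsTopologicalGroup G]
  [CompactSpace G] [MeasurableSpace G] [BorelSpace G] [SecondCountableTopology G]

variable (ι E G) in
/-- The inclusion of the space of smooth functions into the Hilbert space. -/
def smoothToL2 : smoothFunctions ι E G →ₗ[ℂ] L2 G ι :=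
  (ContinuousMap.toLp 2 (configMeasure G ι) ℂ).toLinearMap ∘ₗ
    { toFun := fun f => (⟨f, (show ContMDiff (configModel ι E) 𝓘(ℝ, ℂ) ∞ f.1 from f.2).continuous⟩ :
        C(ι → G, ℂ))
      map_add' := fun _ _ => rfl
      map_smul' := fun _ _ => rfl }

lemma smoothToL2_injective : Function.Injective (smoothToL2 ι E G) := by
  refine (ContinuousMap.toLp_injective (configMeasure G ι)).comp fun f h hfh => ?_
  exact Subtype.ext (congrArg (fun k : C(ι → G, ℂ) => (k : (ι → G) → ℂ)) hfh)

variable [FiniteDimensional ℝ E] [LieGroup 𝓘(ℝ, E) ∞ G]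

/-- The operator `∑_e -(1/2) I_e Δ_e` on the Hilbert space, with the smooth functions as domain. -/
def smoothHamiltonian (B : InvariantInner E G) (c : ι → ℝ) : L2 G ι →ₗ.[ℂ] L2 G ι where
  domain := LinearMap.range (smoothToL2 ι E G)
  toFun := smoothToL2 ι E G ∘ₗ electricMap B c ∘ₗ
    (LinearEquiv.ofInjective (smoothToL2 ι E G) smoothToL2_injective).symm.toLinearMap

/-- The free electric Hamiltonian `H₀`: the closure of `∑_e -(1/2) I_e Δ_e` on smooth functions. -/
def hamiltonian (B : InvariantInner E G) (c : ι → ℝ) : L2 G ι →ₗ.[ℂ] L2 G ι :=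
  (smoothHamiltonian B c).closure

variable {V : Type*} [Quiver V] [Fintype (Quiver.Total V)]

/-- The restriction of the Hamiltonian to `Dom(H₀) ∩ H^𝒢`. -/
def hamiltonianRed (B : InvariantInner E G) (c : Quiver.Total V → ℝ) :
    L2 G (Quiver.Total V) →ₗ.[ℂ] L2 G (Quiver.Total V) :=
  (hamiltonian B c).domRestrict (gaugeInvariant V G)

end Hamiltonian

end LatticeGauge

end

/-!
The tensor `∑ Xₖ ⊗ Xᵏ` does not depend on the choice of dual bases, and `Ad` maps dual bases to dual
bases, so the left-invariant operator `Δ` is also invariant under conjugation. Multiplying `a_{e_k}`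
on the right by `g` multiplies `R(a)_e` on the right by a conjugate of `g` and changes no other
component, because no edge occurs twice in the paths `ι(e)`. Hence `Δ_{e_k} (f ∘ R) = (Δ_e f) ∘ R`
for every edge `e_k` of `ι(e)`, and the coefficients add up along the path. A gauge transformation
has the same effect on right multiplication, so it commutes with the electric operator.

Haar measure is invariant under right multiplication by the integral curves of left-invariant
fields, so these fields are skew-symmetric and the electric operator is symmetric on its dense
domain of smooth functions, hence closable. Composition with `R` or with a gauge transformation is
continuous on `L²`, so the identities on smooth functions pass to the closure.
-/

noncomputable section

namespace LatticeGauge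

section DualFamily

/-- The families `c` and `d` are dual with respect to the bilinear form `B`, i.e. `∑ cᵢ ⊗ dᵢ` is the
Casimir tensor of `B`. This is the relation between a basis and its dual basis, expressed without
linear independence or a common indexing of bases, so that it is visibly preserved by surjective
isometries. -/
def IsDualFamily {R L κ : Type*} [CommSemiring R] [AddCommMonoid L] [Module R L] [Fintype κ]
    (B : LinearMap.BilinForm R L) (c d : κ → L) : Prop :=
  ∀ x, ∑ i, B x (d i) • c i = x

section

variable {R L L' M κ κ' : Type*} [CommRing R] [AddCommGroup L] [Module R L] [AddCommGroup L']
  [Module R L'] [AddCommGroup M] [Module R M] [Fintype κ] [Fintype κ']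
  {B : LinearMap.BilinForm R L} {c d : κ → L} {c' d' : κ' → L}

lemma IsDualFamily.symm (h : IsDualFamily B c d) (hB : B.Nondegenerate) (hs : B.IsSymm) :
    IsDualFamily B d c := by
  intro y
  refine eq_of_sub_eq_zero (hB.2 _ fun x => ?_)
  have hx : B x y = ∑ i, B x (d i) * B y (c i) := by
    conv_lhs => rw [← h x]
    simp [hs.eq y]
  simp [hx, mul_comm]

lemma IsDualFamily.map (h : IsDualFamily B c d) {B' : LinearMap.BilinForm R L'} {A : L →ₗ[R] L'}
    (hA : Function.Surjective A) (hBA : ∀ x y, B' (A x) (A y) = B x y) :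
    IsDualFamily B' (A ∘ c) (A ∘ d) := by
  intro y
  obtain ⟨x, rfl⟩ := hA y
  simpa [hBA] using congrArg A (h x)

lemma IsDualFamily.sum_bilin_eq (h : IsDualFamily B c d) (h' : IsDualFamily B c' d')
    (hB : B.Nondegenerate) (hs : B.IsSymm) (T : L →ₗ[R] L →ₗ[R] M) :
    ∑ i, T (c i) (d i) = ∑ j, T (c' j) (d' j) := by
  calc ∑ i, T (c i) (d i)
      = ∑ i, ∑ j, B (d i) (c' j) • T (c i) (d' j) := by
        refine Finset.sum_congr rfl fun i _ => ?_
        conv_lhs => rw [← h'.symm hB hs (d i)]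
        simp
    _ = ∑ j, T (∑ i, B (c' j) (d i) • c i) (d' j) := by
        rw [Finset.sum_comm]
        simp [fun i j => hs.eq (d i) (c' j)]
    _ = ∑ j, T (c' j) (d' j) := by simp only [h _]

end

lemma isDualFamily_dualBasis {K L ι : Type*} [Field K] [AddCommGroup L] [Module K L] [Fintype ι]
    [DecidableEq ι] {B : LinearMap.BilinForm K L} (hB : B.Nondegenerate) (b : Module.Basis ι K L) :
    IsDualFamily B (B.dualBasis hB b) b := fun x => by
  simpa only [LinearMap.BilinForm.dualBasis_repr_apply] using (B.dualBasis hB b).sum_repr x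

end DualFamily

section InvariantInner

variable {E : Type*} [NormedAddCommGroup E] [NormedSpace ℝ E] [FiniteDimensional ℝ E]
  {G : Type*} [TopologicalSpace G] [ChartedSpace E G] [Group G]

lemma InvariantInner.Ad_surjective (B : InvariantInner E G) (p : G) :
    Function.Surjective (Ad E p) := by
  have hinj : Function.Injective (Ad E p).toLinearMap := by
    refine (injective_iff_map_eq_zero _).2 fun X hX => by_contra fun hX0 => (B.pos X hX0).ne ?_
    have hX : Ad E p X = 0 := hX
    rw [← B.ad_invariant p X X, hX, map_zero]
  exact LinearMap.injective_iff_surjective.1 hinj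

lemma InvariantInner.isDualFamily_finBasis (B : InvariantInner E G) :
    IsDualFamily B.form (Module.finBasis ℝ (GroupLieAlgebra 𝓘(ℝ, E) G))
      (B.form.dualBasis B.nondegenerate (Module.finBasis ℝ (GroupLieAlgebra 𝓘(ℝ, E) G))) :=
  (isDualFamily_dualBasis B.nondegenerate _).symm B.nondegenerate ⟨B.symm⟩

lemma InvariantInner.isDualFamily_Ad {κ : Type*} [Fintype κ] (B : InvariantInner E G)
    {c d : κ → GroupLieAlgebra 𝓘(ℝ, E) G} (h : IsDualFamily B.form c d) (p : G) :
    IsDualFamily B.form (Ad E p ∘ c) (Ad E p ∘ d) :=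
  h.map (A := (Ad E p).toLinearMap) (B.Ad_surjective p) (B.ad_invariant p)

end InvariantInner

section LieDeriv

variable {E : Type*} [NormedAddCommGroup E] [NormedSpace ℝ E]
  {G : Type*} [TopologicalSpace G] [ChartedSpace E G] [Group G]

lemma lieDeriv_const (X : GroupLieAlgebra 𝓘(ℝ, E) G) (z : ℂ) : lieDeriv X (fun _ : G => z) = 0 := by
  funext g
  rw [lieDeriv, mfderiv_const]
  rfl

lemma lieDeriv_add_left (X Y : GroupLieAlgebra 𝓘(ℝ, E) G) (φ : G → ℂ) :
    lieDeriv (X + Y) φ = lieDeriv X φ + lieDeriv Y φ := by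
  funext g
  simp only [lieDeriv, mulInvariantVectorField_add, Pi.add_apply]
  exact map_add _ _ _

lemma lieDeriv_smul_left (t : ℝ) (X : GroupLieAlgebra 𝓘(ℝ, E) G) (φ : G → ℂ) :
    lieDeriv (t • X) φ = (t : ℂ) • lieDeriv X φ := by
  funext g
  simp only [lieDeriv, mulInvariantVectorField_smul, Pi.smul_apply]
  exact map_smul _ _ _

lemma laplacian_const [FiniteDimensional ℝ E] (B : InvariantInner E G) (z : ℂ) :
    laplacian B (fun _ : G => z) = 0 := by
  funext g
  simp [laplacian, lieDeriv_const, Pi.zero_def]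

lemma lieDeriv_one (X : GroupLieAlgebra 𝓘(ℝ, E) G) (φ : G → ℂ) :
    lieDeriv X φ 1 = mfderiv 𝓘(ℝ, E) 𝓘(ℝ, ℂ) φ 1 X := by
  have hX : mulInvariantVectorField X (1 : G) = X := by
    have hone : (fun k : G => 1 * k) = id := funext one_mul
    rw [mulInvariantVectorField, hone, mfderiv_id]
    rfl
  rw [lieDeriv, hX]

variable [LieGroup 𝓘(ℝ, E) ∞ G]

lemma mdifferentiable_mul_left (h : G) :
    MDifferentiable 𝓘(ℝ, E) 𝓘(ℝ, E) fun k : G => h * k :=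
  (contMDiff_mul_left (I := 𝓘(ℝ, E)) (n := ∞)).mdifferentiable (by simp)

lemma mdifferentiable_conj (p : G) :
    MDifferentiable 𝓘(ℝ, E) 𝓘(ℝ, E) fun k : G => p * k * p⁻¹ :=
  ((contMDiff_mul_right (I := 𝓘(ℝ, E)) (n := ∞)).comp
    (contMDiff_mul_left (I := 𝓘(ℝ, E)) (n := ∞))).mdifferentiable (by simp)

variable {φ : G → ℂ}

lemma lieDeriv_comp_mul_left_one (X : GroupLieAlgebra 𝓘(ℝ, E) G)
    (hφ : MDifferentiable 𝓘(ℝ, E) 𝓘(ℝ, ℂ) φ) (g : G) :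
    lieDeriv X (fun k => φ (g * k)) 1 = lieDeriv X φ g := by
  have hcomp := mfderiv_comp (1 : G) (hφ (g * 1)) (mdifferentiable_mul_left g 1)
  rw [lieDeriv_one]
  change mfderiv 𝓘(ℝ, E) 𝓘(ℝ, ℂ) (fun k => φ (g * k)) 1 = _ at hcomp
  rw [hcomp]
  change mfderiv 𝓘(ℝ, E) 𝓘(ℝ, ℂ) φ (g * 1) _ = mfderiv 𝓘(ℝ, E) 𝓘(ℝ, ℂ) φ g _
  rw [mul_one]
  rfl

lemma lieDeriv_comp_conj_one (X : GroupLieAlgebra 𝓘(ℝ, E) G)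
    (hφ : MDifferentiable 𝓘(ℝ, E) 𝓘(ℝ, ℂ) φ) (p : G) :
    lieDeriv X (fun k => φ (p * k * p⁻¹)) 1 = lieDeriv (Ad E p X) φ 1 := by
  have hcomp := mfderiv_comp (1 : G) (hφ (p * 1 * p⁻¹)) (mdifferentiable_conj p 1)
  have hone : p * 1 * p⁻¹ = 1 := by simp
  rw [lieDeriv_one, lieDeriv_one]
  change mfderiv 𝓘(ℝ, E) 𝓘(ℝ, ℂ) (fun k => φ (p * k * p⁻¹)) 1 = _ at hcomp
  rw [hcomp]
  change mfderiv 𝓘(ℝ, E) 𝓘(ℝ, ℂ) φ (p * 1 * p⁻¹) (Ad E p X) = _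
  rw [hone]

lemma lieDeriv_comp_mul_left (X : GroupLieAlgebra 𝓘(ℝ, E) G)
    (hφ : MDifferentiable 𝓘(ℝ, E) 𝓘(ℝ, ℂ) φ) (h : G) :
    lieDeriv X (fun k => φ (h * k)) = fun g => lieDeriv X φ (h * g) := by
  funext g
  rw [← lieDeriv_comp_mul_left_one X hφ,
    ← lieDeriv_comp_mul_left_one (φ := fun k => φ (h * k)) X (hφ.comp (mdifferentiable_mul_left h))]
  simp only [mul_assoc]

lemma lieDeriv_comp_conj (X : GroupLieAlgebra 𝓘(ℝ, E) G)
    (hφ : MDifferentiable 𝓘(ℝ, E) 𝓘(ℝ, ℂ) φ) (p : G) :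
    lieDeriv X (fun k => φ (p * k * p⁻¹)) = fun g => lieDeriv (Ad E p X) φ (p * g * p⁻¹) := by
  funext g
  calc lieDeriv X (fun k => φ (p * k * p⁻¹)) g
      = lieDeriv X (fun k => φ (p * (g * k) * p⁻¹)) 1 :=
        (lieDeriv_comp_mul_left_one X (hφ.comp (mdifferentiable_conj p)) g).symm
    _ = lieDeriv X (fun k => φ (p * g * p⁻¹ * (p * k * p⁻¹))) 1 := by
        simp only [mul_assoc, inv_mul_cancel_left]
    _ = lieDeriv (Ad E p X) (fun k => φ (p * g * p⁻¹ * k)) 1 :=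
        lieDeriv_comp_conj_one X (hφ.comp (mdifferentiable_mul_left _)) p
    _ = lieDeriv (Ad E p X) φ (p * g * p⁻¹) := lieDeriv_comp_mul_left_one _ hφ _

lemma contMDiff_lieDeriv (X : GroupLieAlgebra 𝓘(ℝ, E) G) (hφ : ContMDiff 𝓘(ℝ, E) 𝓘(ℝ, ℂ) ∞ φ) :
    ContMDiff 𝓘(ℝ, E) 𝓘(ℝ, ℂ) ∞ (lieDeriv X φ) := by
  have h := smooth_slice () (smooth_edgeDeriv () X (hφ.comp (contMDiff_eval ∞ ()))) 1
  simpa [edgeDeriv, Function.comp_def] using h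

lemma mdifferentiable_lieDeriv (X : GroupLieAlgebra 𝓘(ℝ, E) G)
    (hφ : ContMDiff 𝓘(ℝ, E) 𝓘(ℝ, ℂ) ∞ φ) :
    MDifferentiable 𝓘(ℝ, E) 𝓘(ℝ, ℂ) (lieDeriv X φ) :=
  (contMDiff_lieDeriv X hφ).mdifferentiable (by simp)

/-- The second derivative `X Y φ` at a point, as a bilinear map in `X` and `Y`. -/
def lieHessian (hφ : ContMDiff 𝓘(ℝ, E) 𝓘(ℝ, ℂ) ∞ φ) (g : G) :
    GroupLieAlgebra 𝓘(ℝ, E) G →ₗ[ℝ] GroupLieAlgebra 𝓘(ℝ, E) G →ₗ[ℝ] ℂ :=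
  LinearMap.mk₂ ℝ (fun X Y => lieDeriv X (lieDeriv Y φ) g)
    (fun X X' _ => congrFun (lieDeriv_add_left X X' _) g)
    (fun t X _ => congrFun (lieDeriv_smul_left t X _) g)
    (fun X Y Y' => by rw [lieDeriv_add_left, lieDeriv_add X (mdifferentiable_lieDeriv Y hφ g)
      (mdifferentiable_lieDeriv Y' hφ g)])
    (fun t X Y => by
      rw [lieDeriv_smul_left, lieDeriv_smul X t (mdifferentiable_lieDeriv Y hφ g)]
      rfl)

variable [FiniteDimensional ℝ E] (B : InvariantInner E G)

lemma laplacian_eq_sum {κ : Type*} [Fintype κ] {c d : κ → GroupLieAlgebra 𝓘(ℝ, E) G}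
    (hcd : IsDualFamily B.form c d) (hφ : ContMDiff 𝓘(ℝ, E) 𝓘(ℝ, ℂ) ∞ φ) (g : G) :
    laplacian B φ g = ∑ i, lieDeriv (c i) (lieDeriv (d i) φ) g :=
  B.isDualFamily_finBasis.sum_bilin_eq hcd B.nondegenerate ⟨B.symm⟩ (lieHessian hφ g)

lemma laplacian_comp_mul_left (hφ : ContMDiff 𝓘(ℝ, E) 𝓘(ℝ, ℂ) ∞ φ) (h g : G) :
    laplacian B (fun k => φ (h * k)) g = laplacian B φ (h * g) := by
  simp only [laplacian, lieDeriv_comp_mul_left _ (hφ.mdifferentiable (by simp)),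
    lieDeriv_comp_mul_left _ (mdifferentiable_lieDeriv _ hφ)]

lemma laplacian_comp_conj (hφ : ContMDiff 𝓘(ℝ, E) 𝓘(ℝ, ℂ) ∞ φ) (p g : G) :
    laplacian B (fun k => φ (p * k * p⁻¹)) g = laplacian B φ (p * g * p⁻¹) := by
  rw [laplacian_eq_sum B (B.isDualFamily_Ad B.isDualFamily_finBasis p) hφ]
  simp only [laplacian, lieDeriv_comp_conj _ (hφ.mdifferentiable (by simp)),
    lieDeriv_comp_conj _ (mdifferentiable_lieDeriv _ hφ), Function.comp_apply]

end LieDeriv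

section EdgeDeriv

lemma mul_mulSingle_eq_update {ι : Type*} [DecidableEq ι] {M : Type*} [MulOneClass M] (a : ι → M)
    (e : ι) (g : M) : a * Pi.mulSingle e g = Function.update a e (a e * g) := by
  conv_lhs => rw [← Function.update_eq_self e a, Pi.mulSingle, ← Function.update_mul, mul_one]

variable {ι κ : Type*} [Fintype ι] [Fintype κ]
  {E : Type*} [NormedAddCommGroup E] [NormedSpace ℝ E]
  {G : Type*} [TopologicalSpace G] [ChartedSpace E G] [Group G] [LieGroup 𝓘(ℝ, E) ∞ G]
  {f : (ι → G) → ℂ}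

lemma edgeLaplacian_eq_sum [FiniteDimensional ℝ E] (B : InvariantInner E G)
    {n : Type*} [Fintype n] {c d : n → GroupLieAlgebra 𝓘(ℝ, E) G}
    (hcd : IsDualFamily B.form c d) (hf : f ∈ smoothFunctions ι E G) (e : ι) :
    edgeLaplacian B e f = ∑ i, edgeDeriv e (c i) (edgeDeriv e (d i) f) := by
  classical
  funext a
  rw [edgeLaplacian, laplacian_eq_sum B hcd (smooth_slice e hf a), Finset.sum_apply]
  refine Finset.sum_congr rfl fun i _ => ?_
  rw [edgeDeriv]
  simp only [edgeDeriv_update]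

variable [DecidableEq ι] [DecidableEq κ]

lemma contMDiff_mul_mulSingle (hf : f ∈ smoothFunctions ι E G) (e : ι) (a : ι → G) :
    ContMDiff 𝓘(ℝ, E) 𝓘(ℝ, ℂ) ∞ fun g => f (a * Pi.mulSingle e g) := by
  refine ContMDiff.comp (I' := configModel ι E) hf
    (contMDiff_into_config fun e' => contMDiff_const.mul ?_)
  rcases eq_or_ne e' e with rfl | he
  · simp only [Pi.mulSingle_eq_same]
    exact contMDiff_id
  · simpa [he] using contMDiff_const

lemma edgeDeriv_eq_lieDeriv_one (hf : f ∈ smoothFunctions ι E G) (e : ι)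
    (X : GroupLieAlgebra 𝓘(ℝ, E) G) (a : ι → G) :
    edgeDeriv e X f a = lieDeriv X (fun g => f (a * Pi.mulSingle e g)) 1 := by
  have h := lieDeriv_comp_mul_left_one X ((smooth_slice e hf a).mdifferentiable (by simp)) (a e)
  rw [edgeDeriv]
  simp only [mul_mulSingle_eq_update]
  convert h.symm

lemma edgeDeriv_mul_mulSingle (hf : f ∈ smoothFunctions ι E G) (e : ι)
    (X : GroupLieAlgebra 𝓘(ℝ, E) G) (a : ι → G) (g : G) :
    edgeDeriv e X f (a * Pi.mulSingle e g) = lieDeriv X (fun k => f (a * Pi.mulSingle e k)) g := by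
  rw [edgeDeriv_eq_lieDeriv_one hf, ← lieDeriv_comp_mul_left_one X
    ((contMDiff_mul_mulSingle hf e a).mdifferentiable (by simp))]
  simp only [mul_assoc, Pi.mulSingle_mul]

variable [FiniteDimensional ℝ E] (B : InvariantInner E G)

lemma edgeLaplacian_eq_laplacian_one (hf : f ∈ smoothFunctions ι E G) (e : ι) (a : ι → G) :
    edgeLaplacian B e f a = laplacian B (fun g => f (a * Pi.mulSingle e g)) 1 := by
  have h := laplacian_comp_mul_left B (smooth_slice e hf a) (a e) 1
  rw [mul_one] at h
  rw [edgeLaplacian]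
  simp only [mul_mulSingle_eq_update]
  convert h.symm

lemma edgeLaplacian_eq_zero (hf : f ∈ smoothFunctions ι E G) {e : ι} {a : ι → G}
    (h : ∀ g, f (a * Pi.mulSingle e g) = f a) : edgeLaplacian B e f a = 0 := by
  rw [edgeLaplacian_eq_laplacian_one B hf]
  simp only [h, laplacian_const, Pi.zero_apply]

lemma edgeLaplacian_comp {Φ : (κ → G) → ι → G} (hf : f ∈ smoothFunctions ι E G)
    (hfΦ : f ∘ Φ ∈ smoothFunctions κ E G) {x : κ} {e : ι} {a : κ → G} {p : G}
    (h : ∀ g, Φ (a * Pi.mulSingle x g) = Φ a * Pi.mulSingle e (p * g * p⁻¹)) :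
    edgeLaplacian B x (f ∘ Φ) a = edgeLaplacian B e f (Φ a) := by
  rw [edgeLaplacian_eq_laplacian_one B hfΦ, edgeLaplacian_eq_laplacian_one B hf]
  simp only [Function.comp_apply, h]
  rw [laplacian_comp_conj B (contMDiff_mul_mulSingle hf e (Φ a))]
  simp

end EdgeDeriv

section IntegrationByParts

lemma integrable_of_continuous {K F : Type*} [TopologicalSpace K] [CompactSpace K]
    [MeasurableSpace K] [OpensMeasurableSpace K] [NormedAddCommGroup F] {μ : Measure K}
    [IsFiniteMeasureOnCompacts μ] {f : K → F} (hf : Continuous f) : Integrable f μ :=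
  hf.integrable_of_hasCompactSupport (.of_compactSpace f)

lemma integral_eq_zero_of_hasDerivAt_mul_right {K F : Type*} [Group K] [TopologicalSpace K]
    [CompactSpace K] [ContinuousMul K] [MeasurableSpace K] [BorelSpace K]
    [NormedAddCommGroup F] [NormedSpace ℝ F]
    {μ : Measure K} [IsFiniteMeasure μ] [μ.IsMulRightInvariant] {f f' : K → F} (hf : Continuous f)
    (hf' : Continuous f') {γ : ℝ → K} (hγ : γ 0 = 1)
    (h : ∀ᶠ t in nhds 0, ∀ a, HasDerivAt (fun s => f (a * γ s)) (f' (a * γ t)) t) :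
    ∫ a, f' a ∂μ = 0 := by
  have hint (g : K) {φ : K → F} (hφ : Continuous φ) : Integrable (fun a => φ (a * g)) μ :=
    integrable_of_continuous (hφ.comp (continuous_mul_const g))
  obtain ⟨C, hC⟩ := isCompact_univ.exists_bound_of_continuousOn hf'.continuousOn
  have hderiv : HasDerivAt (fun t => ∫ a, f (a * γ t) ∂μ) (∫ a, f' (a * γ 0) ∂μ) 0 :=
    (hasDerivAt_integral_of_dominated_loc_of_deriv_le (bound := fun _ => C) h
      (.of_forall fun t => (hint (γ t) hf).aestronglyMeasurable) (hint (γ 0) hf)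
      (hint (γ 0) hf').aestronglyMeasurable (.of_forall fun a t _ => hC _ trivial)
      (integrable_const C) (.of_forall fun a t ht => ht a)).2
  simp only [integral_mul_right_eq_self f, hγ, mul_one] at hderiv
  exact hderiv.unique (hasDerivAt_const _ _)

lemma exists_hasDerivAt_lieDeriv {E : Type*} [NormedAddCommGroup E] [NormedSpace ℝ E]
    [CompleteSpace E] {G : Type*} [TopologicalSpace G] [ChartedSpace E G] [Group G]
    [LieGroup 𝓘(ℝ, E) ∞ G] (X : GroupLieAlgebra 𝓘(ℝ, E) G) :
    ∃ γ : ℝ → G, γ 0 = 1 ∧ ∀ᶠ t in nhds 0, ∀ φ : G → ℂ, MDifferentiable 𝓘(ℝ, E) 𝓘(ℝ, ℂ) φ →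
      HasDerivAt (φ ∘ γ) (lieDeriv X φ (γ t)) t := by
  have : LieGroup 𝓘(ℝ, E) (minSmoothness ℝ 3) G := by
    rw [minSmoothness_of_isRCLikeNormedField]
    exact LieGroup.of_le (n := ∞) ENat.LEInfty.out
  have : IsManifold 𝓘(ℝ, E) 1 G := IsManifold.of_le (n := ∞) (m := 1) (by simp)
  have hX : ContMDiffAt 𝓘(ℝ, E) 𝓘(ℝ, E).tangent 1
      (fun g => (⟨g, mulInvariantVectorField X g⟩ : TangentBundle 𝓘(ℝ, E) G)) 1 :=
    (contMDiff_mulInvariantVectorField X 1).of_le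
      (by rw [minSmoothness_of_isRCLikeNormedField]; norm_num)
  obtain ⟨γ, hγ0, hγ⟩ := exists_isMIntegralCurveAt_of_contMDiffAt_boundaryless 0 hX
  refine ⟨γ, hγ0, hγ.mono fun t ht φ hφ => ?_⟩
  let D : E →L[ℝ] ℂ := mfderiv 𝓘(ℝ, E) 𝓘(ℝ, ℂ) φ (γ t)
  let v : E := mulInvariantVectorField X (γ t)
  have hcomp : HasFDerivAt (φ ∘ γ) (D.comp ((1 : ℝ →L[ℝ] ℝ).smulRight v)) t :=
    hasMFDerivAt_iff_hasFDerivAt.1 ((hφ (γ t)).hasMFDerivAt.comp t ht)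
  have hv : D.comp ((1 : ℝ →L[ℝ] ℝ).smulRight v) 1 = lieDeriv X φ (γ t) :=
    congrArg D (one_smul ℝ v)
  exact hcomp.hasDerivAt.congr_deriv hv

variable {ι : Type*} [Fintype ι] {E : Type*} [NormedAddCommGroup E] [NormedSpace ℝ E]
  {G : Type*} [TopologicalSpace G] [ChartedSpace E G]

lemma continuous_of_smooth {f : (ι → G) → ℂ} (hf : f ∈ smoothFunctions ι E G) : Continuous f :=
  ContMDiff.continuous (I := configModel ι E) (I' := 𝓘(ℝ, ℂ)) (n := ∞) hf

variable [Group G]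

lemma exists_hasDerivAt_edgeDeriv [CompleteSpace E] [LieGroup 𝓘(ℝ, E) ∞ G] (e : ι)
    (X : GroupLieAlgebra 𝓘(ℝ, E) G) :
    ∃ γ : ℝ → ι → G, γ 0 = 1 ∧ ∀ᶠ t in nhds 0, ∀ f ∈ smoothFunctions ι E G, ∀ a,
      HasDerivAt (fun s => f (a * γ s)) (edgeDeriv e X f (a * γ t)) t := by
  classical
  obtain ⟨γ, hγ0, hγ⟩ := exists_hasDerivAt_lieDeriv X
  refine ⟨fun t => Pi.mulSingle e (γ t), by simp [hγ0], hγ.mono fun t ht f hf a => ?_⟩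
  rw [edgeDeriv_mul_mulSingle hf]
  exact ht _ ((contMDiff_mul_mulSingle hf e a).mdifferentiable (by simp))

variable [IsTopologicalGroup G] [CompactSpace G] [MeasurableSpace G] [BorelSpace G]
  [SecondCountableTopology G]

instance configMeasure_isMulRightInvariant : (configMeasure G ι).IsMulRightInvariant :=
  Measure.pi.isMulRightInvariant fun _ : ι => haarProb G

lemma integral_star_mul_edgeDeriv [CompleteSpace E] [LieGroup 𝓘(ℝ, E) ∞ G] (e : ι)
    (X : GroupLieAlgebra 𝓘(ℝ, E) G) {f h : (ι → G) → ℂ} (hf : f ∈ smoothFunctions ι E G)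
    (hh : h ∈ smoothFunctions ι E G) :
    ∫ a, star (f a) * edgeDeriv e X h a ∂(configMeasure G ι) =
      -∫ a, star (edgeDeriv e X f a) * h a ∂(configMeasure G ι) := by
  obtain ⟨γ, hγ0, hγ⟩ := exists_hasDerivAt_edgeDeriv (ι := ι) e X
  have hcont {φ ψ : (ι → G) → ℂ} (hφ : φ ∈ smoothFunctions ι E G)
      (hψ : ψ ∈ smoothFunctions ι E G) : Continuous fun a => star (φ a) * ψ a :=
    (continuous_of_smooth hφ).star.mul (continuous_of_smooth hψ)
  have hleft := hcont (smooth_edgeDeriv e X hf) hh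
  have hright := hcont hf (smooth_edgeDeriv e X hh)
  have hleibniz := integral_eq_zero_of_hasDerivAt_mul_right (μ := configMeasure G ι)
    (hcont hf hh) (hleft.add hright) hγ0
    (hγ.mono fun t ht a => (ht f hf a).star.mul (ht h hh a))
  rw [integral_add' (integrable_of_continuous hleft) (integrable_of_continuous hright)] at hleibniz
  exact eq_neg_of_add_eq_zero_right hleibniz

end IntegrationByParts

section Symmetry

variable {ι : Type*} [Fintype ι] {E : Type*} [NormedAddCommGroup E] [NormedSpace ℝ E]
  {G : Type*} [TopologicalSpace G] [ChartedSpace E G] [Group G]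

/-- The derivation `edgeDeriv e X` as an operator on the space of smooth functions. -/
def edgeDerivMap [LieGroup 𝓘(ℝ, E) ∞ G] (e : ι) (X : GroupLieAlgebra 𝓘(ℝ, E) G) :
    smoothFunctions ι E G →ₗ[ℂ] smoothFunctions ι E G where
  toFun f := ⟨edgeDeriv e X f, smooth_edgeDeriv e X f.2⟩
  map_add' f h := Subtype.ext (edgeDeriv_add e X f.2 h.2)
  map_smul' z f := Subtype.ext (edgeDeriv_smul e X z f.2)

lemma electricMap_eq_sum [LieGroup 𝓘(ℝ, E) ∞ G] [FiniteDimensional ℝ E] (B : InvariantInner E G)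
    (I : ι → ℝ) {κ : Type*} [Fintype κ] {c d : κ → GroupLieAlgebra 𝓘(ℝ, E) G}
    (hcd : IsDualFamily B.form c d) :
    electricMap (ι := ι) B I =
      ∑ e, ((-(1 / 2) * I e : ℝ) : ℂ) • ∑ i, edgeDerivMap e (c i) ∘ₗ edgeDerivMap e (d i) := by
  ext f a
  simp [electricMap, electricOp, edgeLaplacian_eq_sum B hcd f.2, edgeDerivMap]

variable [IsTopologicalGroup G] [CompactSpace G] [MeasurableSpace G] [BorelSpace G]
  [SecondCountableTopology G]

lemma coeFn_smoothToL2 (f : smoothFunctions ι E G) :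
    smoothToL2 ι E G f =ᵐ[configMeasure G ι] f.1 :=
  ContinuousMap.coeFn_toLp _ _

lemma inner_smoothToL2 (f h : smoothFunctions ι E G) :
    inner ℂ (smoothToL2 ι E G f) (smoothToL2 ι E G h) =
      ∫ a, star (f.1 a) * h.1 a ∂(configMeasure G ι) := by
  rw [L2.inner_def]
  refine integral_congr_ae ?_
  filter_upwards [coeFn_smoothToL2 f, coeFn_smoothToL2 h] with a hf hh
  rw [hf, hh, RCLike.inner_apply']
  rfl

variable [LieGroup 𝓘(ℝ, E) ∞ G]

lemma inner_smoothToL2_edgeDerivMap [CompleteSpace E] (e : ι) (X : GroupLieAlgebra 𝓘(ℝ, E) G)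
    (f h : smoothFunctions ι E G) :
    inner ℂ (smoothToL2 ι E G f) (smoothToL2 ι E G (edgeDerivMap e X h)) =
      -inner ℂ (smoothToL2 ι E G (edgeDerivMap e X f)) (smoothToL2 ι E G h) := by
  rw [inner_smoothToL2, inner_smoothToL2]
  exact integral_star_mul_edgeDeriv e X f.2 h.2

lemma inner_smoothToL2_electricMap [FiniteDimensional ℝ E] (B : InvariantInner E G) (I : ι → ℝ)
    (f h : smoothFunctions ι E G) :
    inner ℂ (smoothToL2 ι E G f) (smoothToL2 ι E G (electricMap B I h)) =
      inner ℂ (smoothToL2 ι E G (electricMap B I f)) (smoothToL2 ι E G h) := by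
  have := FiniteDimensional.complete ℝ E
  have hdual := B.isDualFamily_finBasis
  -- Two integrations by parts turn `Xₖ Xᵏ` into `Xᵏ Xₖ`: the two sides use opposite dual families.
  conv_lhs => rw [electricMap_eq_sum B I hdual]
  conv_rhs => rw [electricMap_eq_sum B I (hdual.symm B.nondegenerate ⟨B.symm⟩)]
  simp only [LinearMap.sum_apply, LinearMap.smul_apply, LinearMap.comp_apply, map_sum, map_smul,
    inner_sum, sum_inner, inner_smul_left, inner_smul_right, Complex.conj_ofReal,
    inner_smoothToL2_edgeDerivMap, neg_neg]

end Symmetry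

section Closability

lemma isClosable_of_isFormalAdjoint {𝕜 H : Type*} [RCLike 𝕜] [NormedAddCommGroup H]
    [InnerProductSpace 𝕜 H] [CompleteSpace H] {T : H →ₗ.[𝕜] H} (hT : Dense (T.domain : Set H))
    (hsymm : T.IsFormalAdjoint T) : T.IsClosable :=
  (LinearPMap.adjoint_isClosed hT).isClosable.leIsClosable (hsymm.le_adjoint hT)

variable {ι : Type*} [Fintype ι] {E : Type*} [NormedAddCommGroup E] [NormedSpace ℝ E]
  [FiniteDimensional ℝ E] {G : Type*} [TopologicalSpace G] [ChartedSpace E G]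

lemma dense_smooth_continuousMap [CompactSpace G] [T2Space G] [SecondCountableTopology G]
    [IsManifold 𝓘(ℝ, E) ∞ G] :
    Dense {f : C(ι → G, ℂ) | ⇑f ∈ smoothFunctions ι E G} := by
  let _ := TopologicalSpace.metrizableSpaceMetric (ι → G)
  refine Metric.dense_iff.2 fun φ ε hε => ?_
  obtain ⟨g, hg, -⟩ := φ.continuous.exists_contMDiff_approx (configModel ι E) ⊤
    (continuous_const (y := ε / 2)) fun _ => half_pos hε
  refine ⟨⟨g, g.contMDiff.continuous⟩, ?_, g.contMDiff⟩
  have hdist : dist ⟨g, g.contMDiff.continuous⟩ φ ≤ ε / 2 :=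
    (ContinuousMap.dist_le (half_pos hε).le).2 fun a => (hg a).le
  exact hdist.trans_lt (half_lt_self hε)

variable [Group G] [IsTopologicalGroup G] [CompactSpace G] [MeasurableSpace G] [BorelSpace G]
  [SecondCountableTopology G] [LieGroup 𝓘(ℝ, E) ∞ G]

lemma denseRange_smoothToL2 [T2Space G] : DenseRange (smoothToL2 ι E G) := by
  have hcont : DenseRange (ContinuousMap.toLp (E := ℂ) 2 (configMeasure G ι) ℂ) :=
    ContinuousMap.toLp_denseRange ℂ (configMeasure G ι) ℂ (by simp)
  refine (hcont.dense_image (ContinuousLinearMap.continuous _)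
    (dense_smooth_continuousMap (ι := ι) (E := E) (G := G))).mono ?_
  rintro _ ⟨f, hf, rfl⟩
  exact ⟨⟨f, hf⟩, rfl⟩

lemma mem_graph_smoothHamiltonian (B : InvariantInner E G) (I : ι → ℝ) {z : L2 G ι × L2 G ι} :
    z ∈ (smoothHamiltonian B I).graph ↔
      ∃ f, (smoothToL2 ι E G f, smoothToL2 ι E G (electricMap B I f)) = z := by
  have happly (f : smoothFunctions ι E G) : smoothHamiltonian B I ⟨smoothToL2 ι E G f, f, rfl⟩ =
      smoothToL2 ι E G (electricMap B I f) :=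
    congrArg (fun f => smoothToL2 ι E G (electricMap B I f))
      ((LinearEquiv.ofInjective (smoothToL2 ι E G) smoothToL2_injective).symm_apply_apply f)
  rw [LinearPMap.mem_graph_iff']
  constructor
  · rintro ⟨⟨_, f, rfl⟩, rfl⟩
    exact ⟨f, congrArg _ (happly f).symm⟩
  · rintro ⟨f, rfl⟩
    exact ⟨⟨_, f, rfl⟩, congrArg _ (happly f)⟩

lemma isFormalAdjoint_smoothHamiltonian (B : InvariantInner E G) (I : ι → ℝ) :
    (smoothHamiltonian B I).IsFormalAdjoint (smoothHamiltonian B I) := by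
  intro x y
  obtain ⟨f, hf⟩ := (mem_graph_smoothHamiltonian B I).1 (LinearPMap.mem_graph _ x)
  obtain ⟨h, hh⟩ := (mem_graph_smoothHamiltonian B I).1 (LinearPMap.mem_graph _ y)
  rw [Prod.mk.injEq] at hf hh
  rw [← hf.1, ← hf.2, ← hh.1, ← hh.2]
  exact (inner_smoothToL2_electricMap B I f h).symm

lemma isClosable_smoothHamiltonian [T2Space G] (B : InvariantInner E G) (I : ι → ℝ) :
    (smoothHamiltonian B I).IsClosable :=
  isClosable_of_isFormalAdjoint denseRange_smoothToL2 (isFormalAdjoint_smoothHamiltonian B I)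

end Closability

section Refinement

variable {V W : Type*} [Quiver V] [Quiver W]

lemma map_mul_mulSingle_of_notMem {ι M : Type*} [DecidableEq ι] [MulOneClass M] {l : List ι} {x : ι}
    (hx : x ∉ l) (a : ι → M) (h : M) : l.map (a * Pi.mulSingle x h) = l.map a :=
  List.map_congr_left fun y hy => by simp [ne_of_mem_of_not_mem hy hx]

lemma prod_map_mul_mulSingle_of_nodup {ι K : Type*} [DecidableEq ι] [Group K] {l₁ l₂ : List ι}
    {x : ι} (hl : (l₁ ++ x :: l₂).Nodup) (a : ι → K) (h : K) :
    ((l₁ ++ x :: l₂).map (a * Pi.mulSingle x h)).prod =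
      ((l₁ ++ x :: l₂).map a).prod * ((l₂.map a).prod⁻¹ * h * (l₂.map a).prod) := by
  rw [List.nodup_middle, List.nodup_cons, List.mem_append, not_or] at hl
  simp [map_mul_mulSingle_of_notMem hl.1.1, map_mul_mulSingle_of_notMem hl.1.2, mul_assoc]

lemma Refinement.eq_of_mem_path (r : Refinement V W) {x : Quiver.Total W} {e e' : Quiver.Total V}
    (h : x ∈ r.path e) (h' : x ∈ r.path e') : e = e' :=
  by_contra fun hne => r.edges_disjoint e e' hne h h'

lemma Refinement.sum_mul_of_eq_on_path [Fintype (Quiver.Total V)] [Fintype (Quiver.Total W)]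
    {R : Type*} [NonUnitalNonAssocSemiring R] (r : Refinement V W) (J F : Quiver.Total W → R)
    (K : Quiver.Total V → R) (hmem : ∀ e, ∀ x ∈ r.path e, F x = K e)
    (hnotMem : ∀ x, (∀ e, x ∉ r.path e) → F x = 0) :
    ∑ x, J x * F x = ∑ e, ((r.path e).map J).sum * K e := by
  classical
  have hdisj : (Set.univ : Set (Quiver.Total V)).PairwiseDisjoint fun e => (r.path e).toFinset :=
    fun e _ e' _ hne => Finset.disjoint_left.2 fun x hx hx' =>
      hne (r.eq_of_mem_path (List.mem_toFinset.1 hx) (List.mem_toFinset.1 hx'))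
  calc ∑ x, J x * F x
      = ∑ x ∈ Finset.univ.biUnion fun e => (r.path e).toFinset, J x * F x := by
        refine (Finset.sum_subset (Finset.subset_univ _) fun x _ hx => ?_).symm
        rw [hnotMem x (by simpa using hx), mul_zero]
    _ = ∑ e, ∑ x ∈ (r.path e).toFinset, J x * F x :=
        Finset.sum_biUnion (hdisj.subset (Set.subset_univ _))
    _ = ∑ e, ((r.path e).map J).sum * K e := by
        refine Finset.sum_congr rfl fun e _ => ?_
        have hnodup : (r.path e).Nodup := r.edges_nodup e
        rw [← List.sum_toFinset J hnodup, Finset.sum_mul]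
        exact Finset.sum_congr rfl fun x hx => by rw [hmem e x (List.mem_toFinset.1 hx)]

variable {G : Type*} [Group G]

lemma gaugeAct_mul_mulSingle [DecidableEq (Quiver.Total V)] (g : V → G) (a : Quiver.Total V → G)
    (e : Quiver.Total V) (h : G) :
    gaugeAct g (a * Pi.mulSingle e h) =
      gaugeAct g a * Pi.mulSingle e (g e.right * h * (g e.right)⁻¹) := by
  funext e'
  rcases eq_or_ne e' e with rfl | he
  · simp [gaugeAct, mul_assoc]
  · simp [gaugeAct, he]

variable [DecidableEq (Quiver.Total W)]

lemma Refinement.config_mul_mulSingle_of_notMem (r : Refinement V W) (a : Quiver.Total W → G)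
    {x : Quiver.Total W} (hx : ∀ e, x ∉ r.path e) (h : G) :
    r.config (a * Pi.mulSingle x h) = r.config a :=
  funext fun e => congrArg List.prod (map_mul_mulSingle_of_notMem (hx e) a h)

lemma Refinement.exists_config_mul_mulSingle [DecidableEq (Quiver.Total V)] (r : Refinement V W)
    (a : Quiver.Total W → G) {x : Quiver.Total W} {e : Quiver.Total V} (hx : x ∈ r.path e) :
    ∃ p : G, ∀ h, r.config (a * Pi.mulSingle x h) =
      r.config a * Pi.mulSingle e (p * h * p⁻¹) := by
  obtain ⟨l₁, l₂, hl⟩ := List.append_of_mem hx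
  refine ⟨(l₂.map a).prod⁻¹, fun h => funext fun e' => ?_⟩
  rcases eq_or_ne e' e with rfl | he
  · simpa [Refinement.config, hl] using prod_map_mul_mulSingle_of_nodup (hl ▸ r.edges_nodup e') a h
  · have hx' : x ∉ r.path e' := fun h' => he (r.eq_of_mem_path h' hx)
    simp [Refinement.config, he, map_mul_mulSingle_of_notMem hx']

end Refinement

section ElectricOp

variable {V W : Type*} [Quiver V] [Quiver W]
  [Fintype (Quiver.Total V)] [Fintype (Quiver.Total W)]
  {E : Type*} [NormedAddCommGroup E] [NormedSpace ℝ E]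
  {G : Type*} [TopologicalSpace G] [ChartedSpace E G] [Group G] [LieGroup 𝓘(ℝ, E) ∞ G]
  {f : (Quiver.Total V → G) → ℂ}

lemma contMDiff_prod_map_list {ι : Type*} [Fintype ι] (l : List ι) :
    ContMDiff (configModel ι E) 𝓘(ℝ, E) ∞ fun a : ι → G => (l.map a).prod := by
  induction l with
  | nil => exact contMDiff_const
  | cons x l ih =>
    simp only [List.map_cons, List.prod_cons]
    exact (contMDiff_eval ∞ x).mul ih

lemma smooth_comp_gaugeAct (g : V → G) (hf : f ∈ smoothFunctions (Quiver.Total V) E G) :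
    f ∘ gaugeAct g ∈ smoothFunctions (Quiver.Total V) E G :=
  ContMDiff.comp (I' := configModel (Quiver.Total V) E) hf (contMDiff_into_config fun e =>
    (contMDiff_const.mul (contMDiff_eval ∞ e)).mul contMDiff_const)

lemma smooth_comp_config (r : Refinement V W) (hf : f ∈ smoothFunctions (Quiver.Total V) E G) :
    f ∘ r.config ∈ smoothFunctions (Quiver.Total W) E G :=
  ContMDiff.comp (I' := configModel (Quiver.Total V) E) hf
    (contMDiff_into_config fun e => contMDiff_prod_map_list (r.path e))

variable [FiniteDimensional ℝ E] (B : InvariantInner E G)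

lemma electricOp_comp_gaugeAct (I : Quiver.Total V → ℝ) (g : V → G)
    (hf : f ∈ smoothFunctions (Quiver.Total V) E G) :
    electricOp B I (f ∘ gaugeAct g) = electricOp B I f ∘ gaugeAct g := by
  classical
  funext a
  refine Finset.sum_congr rfl fun e _ => ?_
  rw [edgeLaplacian_comp B hf (smooth_comp_gaugeAct g hf) (gaugeAct_mul_mulSingle g a e)]

lemma electricOp_comp_config (r : Refinement V W) {I : Quiver.Total V → ℝ}
    {J : Quiver.Total W → ℝ} (hIJ : ∀ e, I e = ((r.path e).map J).sum)
    (hf : f ∈ smoothFunctions (Quiver.Total V) E G) :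
    electricOp B J (f ∘ r.config) = electricOp B I f ∘ r.config := by
  classical
  funext a
  have hcast (e : Quiver.Total V) : (I e : ℂ) = ((r.path e).map fun x => (J x : ℂ)).sum := by
    rw [hIJ, ← Complex.ofRealHom_eq_coe, map_list_sum, List.map_map]
    rfl
  have hsum : ∑ x, (J x : ℂ) * edgeLaplacian B x (f ∘ r.config) a =
      ∑ e, (I e : ℂ) * edgeLaplacian B e f (r.config a) := by
    simp only [hcast]
    refine r.sum_mul_of_eq_on_path _ _ _ (fun e x hx => ?_) fun x hx => ?_
    · obtain ⟨p, hp⟩ := r.exists_config_mul_mulSingle a hx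
      exact edgeLaplacian_comp B hf (smooth_comp_config r hf) hp
    · exact edgeLaplacian_eq_zero B (smooth_comp_config r hf) fun h =>
        congrArg f (r.config_mul_mulSingle_of_notMem a hx h)
  simp only [electricOp, Function.comp_apply, mul_assoc, ← Finset.mul_sum, hsum]

end ElectricOp

section Hamiltonian

lemma closure_apply_of_map_graph {R H H' K K' : Type*} [CommRing R] [TopologicalSpace R]
    [AddCommGroup H] [Module R H] [TopologicalSpace H] [ContinuousAdd H] [ContinuousSMul R H]
    [AddCommGroup H'] [Module R H'] [TopologicalSpace H'] [ContinuousAdd H'] [ContinuousSMul R H']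
    [AddCommGroup K] [Module R K] [TopologicalSpace K] [ContinuousAdd K] [ContinuousSMul R K]
    [AddCommGroup K'] [Module R K'] [TopologicalSpace K'] [ContinuousAdd K'] [ContinuousSMul R K']
    {T : H →ₗ.[R] H'} {S : K →ₗ.[R] K'} (hT : T.IsClosable) (hS : S.IsClosable)
    {u : H → K} {v : H' → K'} (hu : Continuous u) (hv : Continuous v)
    (h : ∀ z ∈ T.graph, (u z.1, v z.2) ∈ S.graph) (x : T.closure.domain) :
    ∃ hx : u x ∈ S.closure.domain, S.closure ⟨u x, hx⟩ = v (T.closure x) := by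
  have hmem : (u x, v (T.closure x)) ∈ S.closure.graph := by
    have hx := T.closure.mem_graph x
    rw [← hT.graph_closure_eq_closure_graph] at hx
    rw [← hS.graph_closure_eq_closure_graph]
    exact map_mem_closure (f := Prod.map u v) (hu.prodMap hv) hx h
  obtain ⟨⟨_, hy⟩, rfl, hval⟩ := S.closure.mem_graph_iff.1 hmem
  exact ⟨hy, hval⟩

variable {E : Type*} [NormedAddCommGroup E] [NormedSpace ℝ E]
  {G : Type*} [TopologicalSpace G] [ChartedSpace E G] [Group G] [IsTopologicalGroup G]
  [CompactSpace G] [SecondCountableTopology G] [MeasurableSpace G] [BorelSpace G]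

lemma compMeasurePreserving_smoothToL2 {ι κ : Type*} [Fintype ι] [Fintype κ] {Φ : (κ → G) → ι → G}
    (hΦ : MeasurePreserving Φ (configMeasure G κ) (configMeasure G ι)) (f : smoothFunctions ι E G)
    (hf : f.1 ∘ Φ ∈ smoothFunctions κ E G) :
    Lp.compMeasurePreservingₗᵢ ℂ Φ hΦ (smoothToL2 ι E G f) = smoothToL2 κ E G ⟨f.1 ∘ Φ, hf⟩ :=
  Lp.ext <| (Lp.coeFn_compMeasurePreserving _ hΦ).trans <|
    (hΦ.quasiMeasurePreserving.ae_eq_comp (coeFn_smoothToL2 f)).trans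
      (coeFn_smoothToL2 ⟨f.1 ∘ Φ, hf⟩).symm

variable [FiniteDimensional ℝ E] [LieGroup 𝓘(ℝ, E) ∞ G] (B : InvariantInner E G)

lemma hamiltonian_comp [T2Space G] {ι κ : Type*} [Fintype ι] [Fintype κ] {I : ι → ℝ}
    {J : κ → ℝ} {Φ : (κ → G) → ι → G}
    (hΦ : MeasurePreserving Φ (configMeasure G κ) (configMeasure G ι))
    (hsmooth : ∀ f ∈ smoothFunctions ι E G, f ∘ Φ ∈ smoothFunctions κ E G)
    (hop : ∀ f ∈ smoothFunctions ι E G, electricOp B J (f ∘ Φ) = electricOp B I f ∘ Φ)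
    (ψ : (hamiltonian B I).domain) :
    ∃ h : Lp.compMeasurePreservingₗᵢ ℂ Φ hΦ ψ.1 ∈ (hamiltonian B J).domain,
      hamiltonian B J ⟨Lp.compMeasurePreservingₗᵢ ℂ Φ hΦ ψ, h⟩ =
        Lp.compMeasurePreservingₗᵢ ℂ Φ hΦ (hamiltonian B I ψ) := by
  have hu := (Lp.compMeasurePreservingₗᵢ (p := 2) (E := ℂ) ℂ Φ hΦ).continuous
  refine closure_apply_of_map_graph (isClosable_smoothHamiltonian B I)
    (isClosable_smoothHamiltonian B J) hu hu (fun z hz => ?_) ψ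
  obtain ⟨f, rfl⟩ := (mem_graph_smoothHamiltonian B I).1 hz
  refine (mem_graph_smoothHamiltonian B J).2 ⟨⟨f.1 ∘ Φ, hsmooth _ f.2⟩, ?_⟩
  have hmap : electricMap B J ⟨f.1 ∘ Φ, hsmooth _ f.2⟩ =
      ⟨(electricMap B I f).1 ∘ Φ, hsmooth _ (electricMap B I f).2⟩ := Subtype.ext (hop f.1 f.2)
  rw [hmap, compMeasurePreserving_smoothToL2 hΦ f, compMeasurePreserving_smoothToL2 hΦ]

variable {V W : Type*} [Quiver V] [Quiver W]
  [Fintype (Quiver.Total V)] [Fintype (Quiver.Total W)]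

lemma hamiltonian_u [T2Space G] (r : Refinement V W) {I : Quiver.Total V → ℝ}
    {J : Quiver.Total W → ℝ} (hIJ : ∀ e, I e = ((r.path e).map J).sum)
    (ψ : (hamiltonian B I).domain) :
    ∃ h : r.u G ψ ∈ (hamiltonian B J).domain,
      hamiltonian B J ⟨r.u G ψ, h⟩ = r.u G (hamiltonian B I ψ) :=
  hamiltonian_comp B r.measurePreserving_config (fun _ => smooth_comp_config r)
    (fun _ => electricOp_comp_config B r hIJ) ψ

lemma hamiltonian_gaugeOp [T2Space G] (I : Quiver.Total V → ℝ) (g : V → G)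
    (ψ : (hamiltonian B I).domain) :
    ∃ h : gaugeOp g ψ ∈ (hamiltonian B I).domain,
      hamiltonian B I ⟨gaugeOp g ψ, h⟩ = gaugeOp g (hamiltonian B I ψ) :=
  hamiltonian_comp B (measurePreserving_gaugeAct g) (fun _ => smooth_comp_gaugeAct g)
    (fun _ => electricOp_comp_gaugeAct B I g) ψ

lemma hamiltonianRed_apply (I : Quiver.Total V → ℝ) (ψ : (hamiltonianRed B I).domain) :
    hamiltonianRed B I ψ = hamiltonian B I ⟨ψ, (Submodule.mem_inf.1 ψ.2).2⟩ :=
  LinearPMap.domRestrict_apply rfl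

lemma hamiltonianRed_mem_gaugeInvariant [T2Space G] (I : Quiver.Total V → ℝ)
    (ψ : (hamiltonianRed B I).domain) : hamiltonianRed B I ψ ∈ gaugeInvariant V G := by
  refine mem_gaugeInvariant.2 fun g => ?_
  have hψ : gaugeOp g ψ.1 = ψ := mem_gaugeInvariant.1 (Submodule.mem_inf.1 ψ.2).1 g
  obtain ⟨h, hcomm⟩ := hamiltonian_gaugeOp B I g ⟨ψ, (Submodule.mem_inf.1 ψ.2).2⟩
  rw [hamiltonianRed_apply, ← hcomm]
  exact congrArg (hamiltonian B I) (Subtype.ext hψ)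

end Hamiltonian

end LatticeGauge

end

theorem mainTheorem4
    {E : Type*} [NormedAddCommGroup E] [NormedSpace ℝ E] [FiniteDimensional ℝ E]
    {G : Type*} [TopologicalSpace G] [ChartedSpace E G] [Group G] [LieGroup 𝓘(ℝ, E) ∞ G]
    [IsTopologicalGroup G] [CompactSpace G] [T2Space G] [SecondCountableTopology G]
    [MeasurableSpace G] [BorelSpace G]
    (B : LatticeGauge.InvariantInner E G)
    {V W : Type*} [Quiver V] [Quiver W]
    [Fintype (Quiver.Total V)] [Fintype (Quiver.Total W)]
    (r : LatticeGauge.Refinement V W)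
    (I : Quiver.Total V → ℝ) (J : Quiver.Total W → ℝ)
    (hIJ : ∀ e, I e = ((r.path e).map J).sum) :
    -- the differential operators have closures, so that the Hamiltonians are well defined
    ((LatticeGauge.smoothHamiltonian B I).IsClosable ∧
      (LatticeGauge.smoothHamiltonian B J).IsClosable) ∧
    -- `u` maps the domain into the domain and intertwines the Hamiltonians
    (∀ ψ : (LatticeGauge.hamiltonian B I).domain,
      ∃ h : r.u G ψ ∈ (LatticeGauge.hamiltonian B J).domain,
        LatticeGauge.hamiltonian B J ⟨r.u G ψ, h⟩ = r.u G (LatticeGauge.hamiltonian B I ψ)) ∧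
    -- the restrictions are operators on the gauge invariant subspaces, and the restriction of `u`
    -- maps the domain into the domain and intertwines them
    (∃ (hI : ∀ ψ, LatticeGauge.hamiltonianRed B I ψ ∈ LatticeGauge.gaugeInvariant V G)
      (hJ : ∀ ψ, LatticeGauge.hamiltonianRed B J ψ ∈ LatticeGauge.gaugeInvariant W G),
      ∀ (ψ : LatticeGauge.gaugeInvariant V G)
        (hψ : (ψ : LatticeGauge.L2 G (Quiver.Total V)) ∈ (LatticeGauge.hamiltonianRed B I).domain),
        ∃ h : (r.uRed G ψ : LatticeGauge.L2 G (Quiver.Total W)) ∈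
            (LatticeGauge.hamiltonianRed B J).domain,
          (⟨LatticeGauge.hamiltonianRed B J ⟨r.uRed G ψ, h⟩, hJ _⟩ :
              LatticeGauge.gaugeInvariant W G) =
            r.uRed G ⟨LatticeGauge.hamiltonianRed B I ⟨ψ, hψ⟩, hI _⟩) := by
  refine ⟨⟨LatticeGauge.isClosable_smoothHamiltonian B I,
    LatticeGauge.isClosable_smoothHamiltonian B J⟩, LatticeGauge.hamiltonian_u B r hIJ,
    LatticeGauge.hamiltonianRed_mem_gaugeInvariant B I,
    LatticeGauge.hamiltonianRed_mem_gaugeInvariant B J, fun ψ hψ => ?_⟩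
  obtain ⟨h, h'⟩ := LatticeGauge.hamiltonian_u B r hIJ ⟨ψ, (Submodule.mem_inf.1 hψ).2⟩
  refine ⟨Submodule.mem_inf.2 ⟨(r.uRed G ψ).2, h⟩, Subtype.ext ?_⟩
  exact (LatticeGauge.hamiltonianRed_apply B J _).trans (h'.trans
    (congrArg (r.u G) (LatticeGauge.hamiltonianRed_apply B I ⟨ψ, hψ⟩).symm))
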